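/- Let $r\in\mathbb{R}\setminus\{0\}$, $B>0$, and let $m\ge 1$, $n\ge 0$ be integers with $m>2n$ and $\frac m2-n\notin\mathbb{N}$ (so $m$ is odd). Let $I_k(x)=\sum_{p\ge0}\frac{(x/2)^{2p+k}}{p!\,(p+k)!}$ be the modified Bessel function of the first kind, ${}_1F_1(a,b,x)$ the Kummer confluent hypergeometric function, $(x)_s=\Gamma(x+s)/\Gamma(x)$ the Pochhammer symbol (the integer $s$ may be negative), $Q_1(a,b)=\int_b^\infty x\,e^{-(x^2+a^2)/2}I_0(ax)\,dx$ the first-order Marcum $Q$-function, and $$T_B(m,n,r)=2r^{n-m+1}e^{-r^2}\int_0^B t^{m-n}e^{-t^2}I_n(2rt)\,dt$$ the incomplete Toronto function. Then $$\begin{aligned} T_B(m,n,r)={}&\frac{\Gamma\left(\frac{m+1}2\right)}{r^{m-2n-1}\,n!}\;{}_1F_1\!\left(n+\tfrac{1-m}2,\,n+1,\,-r^2\right)\\ &-\sum_{l=1}^{\frac{m-1}2-n}\ \sum_{j=0}^{\frac{m-1}2-n-l}\frac{r^{n+l}\,\Gamma\left(\frac{m+1}2\right)}{\Gamma(l)\,r^m\left(\frac{m-1}2-j-n\right)_{1-l}}\;\frac{B^{n+l+2j+1}\,I_{n+l-1}(2rB)}{\Gamma(n+l+j+1)\,e^{r^2+B^2}}\\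 &-\sum_{l=1}^{\frac{m+1}2-n}\frac{r^{2n+2l-m-1}\,\Gamma\left(\frac{m+1}2-n\right)}{\Gamma(l)\,\Gamma(n+l)\left(\frac{m+1}2\right)_{1-n-l}}\left\{Q_1\!\left(\sqrt2\,r,\sqrt2\,B\right)+\sum_{i=1}^{n+l-1}\frac{B^i\,I_i(2rB)}{r^i\,e^{r^2+B^2}}\right\}, \end{aligned}$$ where empty sums are $0$. -/

import Mathlib

open MeasureTheory

/-- The modified Bessel function of the first kind `I_n` of integer order `n ≥ 0`, by its
(everywhere absolutely convergent) power series. -/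
noncomputable def besselI (n : ℕ) (x : ℝ) : ℝ :=
  ∑' k : ℕ, (x / 2) ^ (2 * k + n) / ((k.factorial : ℝ) * ((n + k).factorial : ℝ))

/-- The Kummer confluent hypergeometric function `₁F₁(a, b, x)`, by its power series
(for `b` not a non-positive integer). -/
noncomputable def kummer1F1 (a b x : ℝ) : ℝ :=
  ∑' k : ℕ, (ascPochhammer ℝ k).eval a / (ascPochhammer ℝ k).eval b * x ^ k / (k.factorial : ℝ)

/-- The Pochhammer symbol `(x)_s = Γ(x + s) / Γ(x)`, with an integer index that may be
negative. -/
noncomputable def pochhammerSymbol (x : ℝ) (s : ℤ) : ℝ :=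
  Real.Gamma (x + s) / Real.Gamma x

/-- The first-order Marcum Q-function
`Q₁(a, b) = ∫_b^∞ x exp(-(x² + a²)/2) I₀(a x) dx`. -/
noncomputable def marcumQ1 (a b : ℝ) : ℝ :=
  ∫ x in Set.Ioi b, x * Real.exp (-((x ^ 2 + a ^ 2) / 2)) * besselI 0 (a * x)

/-- The incomplete Toronto function
`T_B(m, n, r) = 2 r^(n-m+1) exp(-r²) ∫_0^B t^(m-n) exp(-t²) I_n(2 r t) dt`
for integer indices `m, n`; the powers have integer exponents, so that `r < 0` makes sense. -/
noncomputable def incompleteToronto (B : ℝ) (m n : ℕ) (r : ℝ) : ℝ :=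
  2 * r ^ ((n : ℤ) - (m : ℤ) + 1) * Real.exp (-r ^ 2) *
    ∫ t in (0 : ℝ)..B, t ^ ((m : ℤ) - (n : ℤ)) * Real.exp (-t ^ 2) * besselI n (2 * r * t)

/-! The hypotheses force `m = 2(n + p) + 1`. Write `I_i(2rt) = (rt)^i Φ_i(r²t²)` with `Φ_i` =
`besselSeries i`; since `Φ_i' = Φ_{i+1}`, everything reduces to the moments `M(i, j)` =
`besselMoment r B i j`, and the Toronto function is `M(n, p) / r^(2p)`.

Integration by parts gives `M(i, j+1) = (i+j+1) M(i, j) + r² M(i+1, j)` minus a boundary term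
(`besselMoment_boundary`). Applied `p` times, it expands `M(n, p)` binomially in the `M(n+k, 0)`
(`besselMoment_eq_sum`); the boundary terms form the double sum.

The Bessel recurrence makes `M(i, 0) - M(i+1, 0)` a boundary term, and `M(0, 0) = 1 - Q₁`, so `1 -
M(N, 0)` is the brace of the formula. In `M = 1 - (1 - M)` the ones add up to the terminating Kummer
series and the rest to the Marcum sum. -/

/-! ### The series `Φ_i`: derivative and recurrence. -/

/-- The entire function `∑ y ^ k / (k! (i + k)!)`, the power series factor of the modified
Bessel function of order `i`. -/
noncomputable def besselSeries (i : ℕ) (y : ℝ) : ℝ :=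
  ∑' k : ℕ, y ^ k / ((k.factorial : ℝ) * ((i + k).factorial : ℝ))

theorem summable_besselSeries (i : ℕ) (y : ℝ) :
    Summable fun k : ℕ => y ^ k / ((k.factorial : ℝ) * ((i + k).factorial : ℝ)) := by
  refine Summable.of_norm_bounded (Real.summable_pow_div_factorial |y|) fun k => ?_
  rw [Real.norm_eq_abs, abs_div, abs_pow, abs_of_pos (by positivity :
    (0 : ℝ) < (k.factorial : ℝ) * ((i + k).factorial : ℝ))]
  gcongr
  exact le_mul_of_one_le_right (by positivity) (by exact_mod_cast (i + k).factorial_pos)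

theorem besselI_eq_pow_mul_besselSeries (i : ℕ) (r t : ℝ) :
    besselI i (2 * r * t) = (r * t) ^ i * besselSeries i (r ^ 2 * t ^ 2) := by
  rw [besselI, besselSeries, ← tsum_mul_left]
  refine tsum_congr fun k => ?_
  rw [show 2 * r * t / 2 = r * t by ring, ← mul_pow, pow_add, pow_mul]
  ring

theorem hasDerivAt_besselSeries (i : ℕ) (y : ℝ) :
    HasDerivAt (besselSeries i) (besselSeries (i + 1) y) y := by
  have hu := Real.summable_pow_div_factorial (|y| + 1)
  -- Majorant of the differentiated terms on the ball of radius `|y| + 1`; truncation at `k = 0` is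
  -- harmless, as that term vanishes.
  have hu' : Summable fun k : ℕ => (|y| + 1) ^ (k - 1) / ((k - 1).factorial : ℝ) :=
    (summable_nat_add_iff 1).1 (by simpa using hu)
  have key := hasDerivAt_tsum_of_isPreconnected
    (g := fun (k : ℕ) (z : ℝ) => z ^ k / ((k.factorial : ℝ) * ((i + k).factorial : ℝ)))
    (g' := fun (k : ℕ) (z : ℝ) => k * z ^ (k - 1) / ((k.factorial : ℝ) * ((i + k).factorial : ℝ)))
    hu' (t := Metric.ball (0 : ℝ) (|y| + 1)) Metric.isOpen_ball
    (convex_ball _ _).isPreconnected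
    (fun k z _ => (hasDerivAt_pow k z).div_const _) ?_
    (y₀ := y) (y := y) (by simp) (summable_besselSeries i y) (by simp)
  · have hd : Summable fun k : ℕ => k * y ^ (k - 1) /
        ((k.factorial : ℝ) * ((i + k).factorial : ℝ)) := by
      refine (summable_nat_add_iff 1).1 ((summable_besselSeries (i + 1) y).congr fun k => ?_)
      rw [Nat.factorial_succ k, show i + (k + 1) = i + 1 + k by ring]
      push_cast
      field_simp
    rw [hd.tsum_eq_zero_add] at key
    refine HasDerivAt.congr_deriv (f := besselSeries i) key ?_
    rw [besselSeries]
    simp only [Nat.cast_zero, zero_mul, zero_div, zero_add]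
    refine tsum_congr fun k => ?_
    rw [Nat.factorial_succ k, show i + (k + 1) = i + 1 + k by ring]
    push_cast
    field_simp
  · intro k z hz
    rcases k with _ | k
    · simp
    have hz' : |z| ≤ |y| + 1 := by
      simpa using (Metric.mem_ball.1 hz).le
    rw [Nat.factorial_succ k, Nat.add_sub_cancel, Nat.cast_mul,
      show ((k + 1 : ℕ) : ℝ) * z ^ k / (((k + 1 : ℕ) : ℝ) * (k.factorial : ℝ) *
        ((i + (k + 1)).factorial : ℝ)) = z ^ k / ((k.factorial : ℝ) *
        ((i + (k + 1)).factorial : ℝ)) by push_cast; field_simp]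
    rw [Real.norm_eq_abs, abs_div, abs_pow, abs_of_pos (by positivity :
      (0 : ℝ) < (k.factorial : ℝ) * ((i + (k + 1)).factorial : ℝ))]
    gcongr
    exact le_mul_of_one_le_right (by positivity) (by exact_mod_cast (i + (k + 1)).factorial_pos)

theorem continuous_besselSeries (i : ℕ) : Continuous (besselSeries i) :=
  continuous_iff_continuousAt.2 fun y => (hasDerivAt_besselSeries i y).continuousAt

theorem besselSeries_recurrence (i : ℕ) (y : ℝ) :
    besselSeries i y = (i + 1) * besselSeries (i + 1) y + y * besselSeries (i + 2) y := by
  have h2 : y * besselSeries (i + 2) y = ∑' k : ℕ, (k : ℝ) * y ^ k /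
      ((k.factorial : ℝ) * ((i + 1 + k).factorial : ℝ)) := by
    have e : ∀ k : ℕ, ((k + 1 : ℕ) : ℝ) * y ^ (k + 1) /
        (((k + 1).factorial : ℝ) * ((i + 1 + (k + 1)).factorial : ℝ)) =
        y * (y ^ k / ((k.factorial : ℝ) * ((i + 2 + k).factorial : ℝ))) := fun k => by
      rw [Nat.factorial_succ k, show i + 1 + (k + 1) = i + 2 + k by ring]
      push_cast
      field_simp
      ring
    rw [Summable.tsum_eq_zero_add, besselSeries, ← tsum_mul_left]
    · simp only [e]; simp
    · refine (summable_nat_add_iff 1).1 ?_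
      simp only [e]
      exact (summable_besselSeries (i + 2) y).mul_left y
  have hs : Summable fun k : ℕ => (k : ℝ) * y ^ k /
      ((k.factorial : ℝ) * ((i + 1 + k).factorial : ℝ)) := by
    have := ((summable_besselSeries i y).sub ((summable_besselSeries (i + 1) y).mul_left (i + 1 : ℝ)))
    refine this.congr fun k => ?_
    rw [show i + 1 + k = (i + k) + 1 by ring, Nat.factorial_succ (i + k)]
    push_cast
    field_simp
    ring
  rw [h2, besselSeries, besselSeries, ← tsum_mul_left,
    ← ((summable_besselSeries (i + 1) y).mul_left _).tsum_add hs]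
  refine tsum_congr fun k => ?_
  rw [show i + 1 + k = (i + k) + 1 by ring, Nat.factorial_succ (i + k)]
  push_cast
  field_simp
  ring

/-! ### Moments and integration by parts. -/

/-- The integral `∫₀^B 2 t ^ (2 (i + j) + 1) exp (-(r² + t²)) Φᵢ(r² t²) dt`, where `Φᵢ` is
`besselSeries i`. -/
noncomputable def besselMoment (r B : ℝ) (i j : ℕ) : ℝ :=
  ∫ t in (0 : ℝ)..B, 2 * t ^ (2 * (i + j) + 1) * Real.exp (-(r ^ 2 + t ^ 2)) *
    besselSeries i (r ^ 2 * t ^ 2)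

theorem continuous_besselMoment_integrand (r : ℝ) (i k : ℕ) :
    Continuous fun t : ℝ => 2 * t ^ k * Real.exp (-(r ^ 2 + t ^ 2)) *
      besselSeries i (r ^ 2 * t ^ 2) := by
  have := continuous_besselSeries i
  fun_prop

theorem hasDerivAt_boundary (r t : ℝ) (i k : ℕ) :
    HasDerivAt (fun t : ℝ => t ^ (2 * (k + 1)) * Real.exp (-(r ^ 2 + t ^ 2)) *
        besselSeries i (r ^ 2 * t ^ 2))
      ((k + 1) * (2 * t ^ (2 * k + 1) * Real.exp (-(r ^ 2 + t ^ 2)) *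
          besselSeries i (r ^ 2 * t ^ 2)) +
        r ^ 2 * (2 * t ^ (2 * (k + 1) + 1) * Real.exp (-(r ^ 2 + t ^ 2)) *
          besselSeries (i + 1) (r ^ 2 * t ^ 2)) -
        2 * t ^ (2 * (k + 1) + 1) * Real.exp (-(r ^ 2 + t ^ 2)) *
          besselSeries i (r ^ 2 * t ^ 2)) t := by
  have h1 := hasDerivAt_pow (2 * (k + 1)) t
  have h2 : HasDerivAt (fun t : ℝ => Real.exp (-(r ^ 2 + t ^ 2)))
      (Real.exp (-(r ^ 2 + t ^ 2)) * (-(2 * t))) t := by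
    have := (((hasDerivAt_pow 2 t).const_add (r ^ 2)).fun_neg).exp
    simpa using this
  have h3 : HasDerivAt (fun t : ℝ => besselSeries i (r ^ 2 * t ^ 2))
      (besselSeries (i + 1) (r ^ 2 * t ^ 2) * (r ^ 2 * (2 * t))) t := by
    have := (hasDerivAt_besselSeries i (r ^ 2 * t ^ 2)).comp t
      ((hasDerivAt_pow 2 t).const_mul (r ^ 2))
    simpa [Function.comp_def] using this
  refine ((h1.fun_mul h2).fun_mul h3).congr_deriv ?_
  rw [show 2 * (k + 1) - 1 = 2 * k + 1 by omega]
  push_cast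
  ring

theorem besselMoment_boundary (r B : ℝ) (i j : ℕ) :
    B ^ (2 * (i + j + 1)) * Real.exp (-(r ^ 2 + B ^ 2)) * besselSeries i (r ^ 2 * B ^ 2) =
      (i + j + 1) * besselMoment r B i j + r ^ 2 * besselMoment r B (i + 1) j -
        besselMoment r B i (j + 1) := by
  have ii : ∀ i k, IntervalIntegrable (fun t : ℝ => 2 * t ^ k * Real.exp (-(r ^ 2 + t ^ 2)) *
      besselSeries i (r ^ 2 * t ^ 2)) volume 0 B := fun i k =>
    (continuous_besselMoment_integrand r i k).intervalIntegrable _ _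
  have h := intervalIntegral.integral_eq_sub_of_hasDerivAt
    (fun t _ => hasDerivAt_boundary r t i (i + j)) (a := 0) (b := B)
    ((((ii _ _).const_mul _).add ((ii _ _).const_mul _)).sub (ii _ _))
  rw [intervalIntegral.integral_sub (((ii _ _).const_mul _).add ((ii _ _).const_mul _)) (ii _ _),
    intervalIntegral.integral_add ((ii _ _).const_mul _) ((ii _ _).const_mul _),
    intervalIntegral.integral_const_mul, intervalIntegral.integral_const_mul] at h
  simp only [besselMoment]
  rw [show i + 1 + j = i + j + 1 by ring, ← add_assoc i j 1]
  push_cast at h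
  rw [h]
  simp

/-- By `besselSeries_recurrence`, the integrand of the difference is the exact derivative of
`t^(2(i+1)) exp(-(r² + t²)) Φ_{i+1}(r²t²)`. -/
theorem besselMoment_sub (r B : ℝ) (i : ℕ) :
    besselMoment r B i 0 - besselMoment r B (i + 1) 0 =
      B ^ (2 * (i + 1)) * Real.exp (-(r ^ 2 + B ^ 2)) *
        besselSeries (i + 1) (r ^ 2 * B ^ 2) := by
  have ii : ∀ i k, IntervalIntegrable (fun t : ℝ => 2 * t ^ k * Real.exp (-(r ^ 2 + t ^ 2)) *
      besselSeries i (r ^ 2 * t ^ 2)) volume 0 B := fun i k =>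
    (continuous_besselMoment_integrand r i k).intervalIntegrable _ _
  have h := intervalIntegral.integral_eq_sub_of_hasDerivAt
    (fun t _ => hasDerivAt_boundary r t (i + 1) i) (a := 0) (b := B)
    ((((ii _ _).const_mul _).add ((ii _ _).const_mul _)).sub (ii _ _))
  rw [besselMoment, besselMoment, ← intervalIntegral.integral_sub (ii _ _) (ii _ _)]
  simp only [ne_eq, mul_eq_zero, OfNat.ofNat_ne_zero, Nat.add_eq_zero_iff, one_ne_zero, and_false,
    or_self, not_false_eq_true, zero_pow, zero_mul, sub_zero] at h
  rw [← h]
  refine intervalIntegral.integral_congr fun t _ => ?_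
  simp only [besselSeries_recurrence i, add_zero]
  ring

/-! ### The Marcum function as a complementary moment. -/

/-- Termwise integration turns the series into the Poisson weights `exp(-r²) r^(2k) / k!`, whose sum
is 1. -/
theorem integral_Ioi_besselSeries_zero (r : ℝ) :
    ∫ t in Set.Ioi (0 : ℝ), 2 * t * Real.exp (-(r ^ 2 + t ^ 2)) *
      besselSeries 0 (r ^ 2 * t ^ 2) = 1 := by
  set c : ℕ → ℝ := fun k => 2 * Real.exp (-r ^ 2) * (r ^ 2) ^ k /
    ((k.factorial : ℝ) * (k.factorial : ℝ)) with hc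
  set F : ℕ → ℝ → ℝ := fun k t => c k * (t ^ ((2 * k + 1 : ℕ) : ℝ) * Real.exp (-t ^ (2 : ℝ)))
    with hF
  have hc0 : ∀ k, 0 ≤ c k := fun k => by positivity
  have hexp : (-1 : ℝ) < 0 := by norm_num
  have hint : ∀ k, IntegrableOn (F k) (Set.Ioi 0) := fun k =>
    (integrableOn_rpow_mul_exp_neg_rpow (hexp.trans_le (by positivity)) two_pos).const_mul _
  have hval : ∀ k, ∫ t in Set.Ioi (0 : ℝ), F k t =
      Real.exp (-r ^ 2) * ((r ^ 2) ^ k / (k.factorial : ℝ)) := fun k => by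
    rw [integral_const_mul,
      integral_rpow_mul_exp_neg_rpow two_pos (hexp.trans_le (by positivity)),
      show (((2 * k + 1 : ℕ) : ℝ) + 1) / 2 = k + 1 by push_cast; ring, Real.Gamma_nat_eq_factorial]
    simp only [hc]
    field_simp
  have hnorm : ∀ k, ∫ t in Set.Ioi (0 : ℝ), ‖F k t‖ = ∫ t in Set.Ioi (0 : ℝ), F k t := fun k =>
    setIntegral_congr_fun measurableSet_Ioi fun t ht => by
      have ht' : (0 : ℝ) < t := ht
      exact Real.norm_of_nonneg (mul_nonneg (hc0 k) (by positivity))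
  have hsum : HasSum (fun k => Real.exp (-r ^ 2) * ((r ^ 2) ^ k / (k.factorial : ℝ))) 1 := by
    have := (NormedSpace.expSeries_div_hasSum_exp (r ^ 2)).mul_left (Real.exp (-r ^ 2))
    rwa [← Real.exp_eq_exp_ℝ, ← Real.exp_add, neg_add_cancel, Real.exp_zero] at this
  have key := hasSum_integral_of_summable_integral_norm (μ := volume.restrict (Set.Ioi 0))
    hint (by simpa only [hnorm, hval] using hsum.summable)
  simp only [hval] at key
  rw [← key.unique hsum]
  refine setIntegral_congr_fun measurableSet_Ioi fun t _ => ?_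
  simp only [besselSeries, hF, hc]
  rw [← tsum_mul_left]
  refine tsum_congr fun k => ?_
  rw [Real.rpow_natCast, Real.rpow_two, zero_add, neg_add, Real.exp_add]
  ring

theorem marcumQ1_eq_one_sub_besselMoment (r B : ℝ) (hB : 0 < B) :
    marcumQ1 (Real.sqrt 2 * r) (Real.sqrt 2 * B) = 1 - besselMoment r B 0 0 := by
  have hs : 0 < Real.sqrt 2 := by positivity
  have h2 : Real.sqrt 2 ^ 2 = 2 := Real.sq_sqrt (by norm_num)
  have htot := integral_Ioi_besselSeries_zero r
  have hint : IntegrableOn (fun t : ℝ => 2 * t * Real.exp (-(r ^ 2 + t ^ 2)) *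
      besselSeries 0 (r ^ 2 * t ^ 2)) (Set.Ioi 0) :=
    -- A non-integrable function would have integral 0 by convention, not 1.
    Integrable.of_integral_ne_zero (by rw [htot]; exact one_ne_zero)
  have h := intervalIntegral.integral_Ioi_sub_Ioi hint hB.le
  rw [htot] at h
  have h' : marcumQ1 (Real.sqrt 2 * r) (Real.sqrt 2 * B) =
      ∫ t in Set.Ioi B, 2 * t * Real.exp (-(r ^ 2 + t ^ 2)) *
        besselSeries 0 (r ^ 2 * t ^ 2) := by
    -- Substitution `x = √2 t`.
    have hsub := integral_comp_mul_left_Ioi (fun x => x *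
      Real.exp (-((x ^ 2 + (Real.sqrt 2 * r) ^ 2) / 2)) * besselI 0 (Real.sqrt 2 * r * x)) B hs
    rw [smul_eq_mul, eq_inv_mul_iff_mul_eq₀ hs.ne', ← integral_const_mul] at hsub
    rw [marcumQ1, ← hsub]
    refine integral_congr_ae (Filter.Eventually.of_forall fun t => ?_)
    simp only
    rw [show Real.sqrt 2 * r * (Real.sqrt 2 * t) = 2 * r * t by linear_combination r * t * h2,
      besselI_eq_pow_mul_besselSeries, mul_pow, mul_pow, h2,
      show -((2 * t ^ 2 + 2 * r ^ 2) / 2) = -(r ^ 2 + t ^ 2) by ring]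
    linear_combination t * Real.exp (-(r ^ 2 + t ^ 2)) * besselSeries 0 (r ^ 2 * t ^ 2) * h2
  have h0 : besselMoment r B 0 0 = ∫ t in (0 : ℝ)..B, 2 * t * Real.exp (-(r ^ 2 + t ^ 2)) *
      besselSeries 0 (r ^ 2 * t ^ 2) := by simp [besselMoment]
  rw [h', h0, ← h]
  ring

theorem one_sub_besselMoment_eq (r B : ℝ) (hr : r ≠ 0) (hB : 0 < B) (N : ℕ) :
    marcumQ1 (Real.sqrt 2 * r) (Real.sqrt 2 * B) +
      ∑ i ∈ Finset.Icc 1 N, B ^ i * besselI i (2 * r * B) /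
        (r ^ i * Real.exp (r ^ 2 + B ^ 2)) = 1 - besselMoment r B N 0 := by
  induction N with
  | zero => simpa using marcumQ1_eq_one_sub_besselMoment r B hB
  | succ N ih =>
    rw [Finset.sum_Icc_succ_top (by omega), ← add_assoc, ih, besselI_eq_pow_mul_besselSeries]
    have h := besselMoment_sub r B N
    rw [Real.exp_neg] at h
    have : B ^ (N + 1) * ((r * B) ^ (N + 1) * besselSeries (N + 1) (r ^ 2 * B ^ 2)) /
        (r ^ (N + 1) * Real.exp (r ^ 2 + B ^ 2)) = B ^ (2 * (N + 1)) *
        (Real.exp (r ^ 2 + B ^ 2))⁻¹ * besselSeries (N + 1) (r ^ 2 * B ^ 2) := by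
      rw [mul_pow]
      field_simp
      ring
    rw [this]
    linear_combination -h

/-! ### Binomial sums. -/

theorem kummer1F1_neg_nat (p n : ℕ) (y : ℝ) :
    kummer1F1 (-p) (n + 1) (-y) = ∑ k ∈ Finset.range (p + 1),
      (p.choose k : ℝ) * (n.factorial / (n + k).factorial) * y ^ k := by
  rw [kummer1F1, tsum_eq_sum (s := Finset.range (p + 1))]
  · refine Finset.sum_congr rfl fun k _ => ?_
    rw [ascPochhammer_eval_neg_eq_descPochhammer, descPochhammer_eval_eq_descFactorial,
      Nat.descFactorial_eq_factorial_mul_choose, neg_pow y,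
      show (n : ℝ) + 1 = ((n + 1 : ℕ) : ℝ) by push_cast; rfl, ← ascPochhammer_eval_cast,
      ascPochhammer_nat_eq_ascFactorial, ← Nat.factorial_mul_ascFactorial n k]
    have h1 : ((n + 1).ascFactorial k : ℝ) ≠ 0 := by
      exact_mod_cast (Nat.ascFactorial_pos n k).ne'
    -- The signs of `(-p)_k` and `(-y)^k` cancel.
    have h2 : ((-1 : ℝ) ^ k) ^ 2 = 1 := by rw [← pow_mul, mul_comm, pow_mul]; simp
    push_cast
    field_simp
    linear_combination (p.choose k : ℝ) * y ^ k * h2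
  · intro k hk
    rw [ascPochhammer_eval_neg_coe_nat_of_lt (by simpa [Nat.lt_succ_iff] using hk)]
    simp

/-- Pascal's rule, with a range long enough to serve every row: the surplus binomials vanish. -/
theorem sum_choose_succ_mul (f : ℕ → ℝ) {q p : ℕ} (h : q < p) :
    ∑ k ∈ Finset.range (p + 1), ((q + 1).choose k : ℝ) * f k =
      ∑ k ∈ Finset.range p, (q.choose k : ℝ) * (f k + f (k + 1)) := by
  have h0 : ∑ k ∈ Finset.range p, (q.choose k : ℝ) * f k =
      ∑ k ∈ Finset.range (p + 1), (q.choose k : ℝ) * f k := by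
    rw [Finset.sum_range_succ, Nat.choose_eq_zero_of_lt h]; simp
  simp only [mul_add, Finset.sum_add_distrib]
  rw [h0, Finset.sum_range_succ', Finset.sum_range_succ' (fun k => (q.choose k : ℝ) * f k)]
  simp only [Nat.choose_succ_succ, Nat.cast_add, add_mul, Finset.sum_add_distrib,
    Nat.choose_zero_right]
  ring

theorem besselMoment_eq_sum (r B : ℝ) (n p : ℕ) :
    besselMoment r B n p =
      ∑ k ∈ Finset.range (p + 1), (p.choose k : ℝ) * ((n + p).factorial / (n + k).factorial) *
        (r ^ 2) ^ k * besselMoment r B (n + k) 0 -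
      ∑ j ∈ Finset.range p, ∑ k ∈ Finset.range p, ((p - 1 - j).choose k : ℝ) *
        ((n + p).factorial / (n + k + j + 1).factorial * (r ^ 2) ^ k *
          (B ^ (2 * (n + k + j + 1)) * Real.exp (-(r ^ 2 + B ^ 2)) *
            besselSeries (n + k) (r ^ 2 * B ^ 2))) := by
  -- The expansion after lowering the second index from `p` to `j`: `S p` is the moment itself, `S
  -- 0` the target sum, and each difference is a row of boundary terms.
  set S : ℕ → ℝ := fun j => ∑ k ∈ Finset.range (p + 1), ((p - j).choose k : ℝ) *
    ((n + p).factorial / (n + k + j).factorial * (r ^ 2) ^ k * besselMoment r B (n + k) j) with hS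
  have hstep : ∀ j ∈ Finset.range p, ∑ k ∈ Finset.range p, ((p - 1 - j).choose k : ℝ) *
        ((n + p).factorial / (n + k + j + 1).factorial * (r ^ 2) ^ k *
          (B ^ (2 * (n + k + j + 1)) * Real.exp (-(r ^ 2 + B ^ 2)) *
            besselSeries (n + k) (r ^ 2 * B ^ 2))) = S j - S (j + 1) := by
    intro j hj
    have hj' := Finset.mem_range.1 hj
    obtain ⟨q, rfl⟩ : ∃ q, p = q + 1 + j := ⟨p - 1 - j, by omega⟩
    simp only [hS]
    rw [show q + 1 + j - j = q + 1 by omega, show q + 1 + j - (j + 1) = q by omega,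
      show q + 1 + j - 1 - j = q by omega, sum_choose_succ_mul _ (by omega),
      Finset.sum_range_succ _ (q + 1 + j), Nat.choose_eq_zero_of_lt (by omega : q < q + 1 + j),
      Nat.cast_zero, zero_mul, add_zero, ← Finset.sum_sub_distrib]
    refine Finset.sum_congr rfl fun k _ => ?_
    have hb := besselMoment_boundary r B (n + k) j
    rw [hb, ← mul_sub, show n + (k + 1) + j = n + k + j + 1 by ring,
      show n + k + (j + 1) = n + k + j + 1 by ring, show n + (k + 1) = n + k + 1 by ring,
      Nat.factorial_succ (n + k + j)]
    push_cast
    field_simp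
    ring
  rw [Finset.sum_congr rfl hstep, Finset.sum_range_sub']
  have hSp : S p = besselMoment r B n p := by
    simp only [hS, Nat.sub_self]
    rw [Finset.sum_range_succ']
    simp [Nat.factorial_ne_zero]
  have hS0 : S 0 = ∑ k ∈ Finset.range (p + 1), (p.choose k : ℝ) *
      ((n + p).factorial / (n + k).factorial) * (r ^ 2) ^ k * besselMoment r B (n + k) 0 := by
    simp only [hS, Nat.sub_zero, add_zero, mul_assoc]
  rw [hSp, hS0]
  ring

/-! ### Matching Gamma and Pochhammer factors with factorials. -/

theorem incompleteToronto_eq_besselMoment (r B : ℝ) (hr : r ≠ 0) (n p : ℕ) :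
    incompleteToronto B (2 * (n + p) + 1) n r = besselMoment r B n p / (r ^ 2) ^ p := by
  rw [eq_div_iff (by positivity), incompleteToronto, besselMoment,
    ← intervalIntegral.integral_const_mul, ← intervalIntegral.integral_mul_const]
  refine intervalIntegral.integral_congr fun t _ => ?_
  rw [besselI_eq_pow_mul_besselSeries, neg_add, Real.exp_add,
    show ((2 * (n + p) + 1 : ℕ) : ℤ) - (n : ℤ) = ((n + 2 * p + 1 : ℕ) : ℤ) by push_cast; ring,
    show (n : ℤ) - ((2 * (n + p) + 1 : ℕ) : ℤ) + 1 = -((n + 2 * p : ℕ) : ℤ) by push_cast; ring,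
    zpow_neg, zpow_natCast, zpow_natCast]
  field_simp
  ring

theorem pochhammerSymbol_natCast (a k : ℕ) :
    pochhammerSymbol ((a : ℝ) + k + 1) (-(k : ℤ)) = a.factorial / (a + k).factorial := by
  rw [pochhammerSymbol]
  push_cast
  rw [show (a : ℝ) + k + 1 + -k = a + 1 by ring, Real.Gamma_nat_eq_factorial,
    show (a : ℝ) + k + 1 = ((a + k : ℕ) : ℝ) + 1 by push_cast; ring, Real.Gamma_nat_eq_factorial]

theorem sum_Icc_one_eq_sum_range (f : ℕ → ℝ) (N : ℕ) :
    ∑ l ∈ Finset.Icc 1 N, f l = ∑ k ∈ Finset.range N, f (k + 1) := by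
  induction N with
  | zero => simp
  | succ N ih => rw [Finset.sum_Icc_succ_top (by omega), ih, Finset.sum_range_succ]

theorem marcum_coefficient_eq (r : ℝ) (hr : r ≠ 0) (n q k : ℕ) :
    r ^ (2 * (n : ℤ) + 2 * ((k + 1 : ℕ) : ℤ) - ((2 * (n + (q + k)) + 1 : ℕ) : ℤ) - 1) *
        Real.Gamma ((((2 * (n + (q + k)) + 1 : ℕ) : ℝ) + 1) / 2 - (n : ℝ)) /
      (Real.Gamma ((k + 1 : ℕ) : ℝ) * Real.Gamma ((n : ℝ) + ((k + 1 : ℕ) : ℝ)) *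
        pochhammerSymbol ((((2 * (n + (q + k)) + 1 : ℕ) : ℝ) + 1) / 2)
          (1 - (n : ℤ) - ((k + 1 : ℕ) : ℤ))) =
      ((q + k).choose k : ℝ) * ((n + (q + k)).factorial / (n + k).factorial) * (r ^ 2) ^ k /
        (r ^ 2) ^ (q + k) := by
  have e1 : (((2 * (n + (q + k)) + 1 : ℕ) : ℝ) + 1) / 2 - (n : ℝ) = ((q + k : ℕ) : ℝ) + 1 := by
    push_cast; ring
  have e2 : (((2 * (n + (q + k)) + 1 : ℕ) : ℝ) + 1) / 2 = (q : ℝ) + ((n + k : ℕ) : ℝ) + 1 := by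
    push_cast; ring
  have e3 : (n : ℝ) + ((k + 1 : ℕ) : ℝ) = ((n + k : ℕ) : ℝ) + 1 := by push_cast; ring
  have e4 : 1 - (n : ℤ) - ((k + 1 : ℕ) : ℤ) = -((n + k : ℕ) : ℤ) := by push_cast; ring
  have e5 : 2 * (n : ℤ) + 2 * ((k + 1 : ℕ) : ℤ) - ((2 * (n + (q + k)) + 1 : ℕ) : ℤ) - 1 =
      -((2 * q : ℕ) : ℤ) := by push_cast; ring
  have hC : ((q + k).choose k : ℝ) = (q + k).factorial / (k.factorial * q.factorial) := by
    rw [add_comm q k, Nat.cast_add_choose]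
  rw [e1, e2, e3, e4, e5, hC, pochhammerSymbol_natCast, Real.Gamma_nat_eq_factorial,
    Real.Gamma_nat_eq_factorial, Nat.cast_succ k, Real.Gamma_nat_eq_factorial, zpow_neg,
    zpow_natCast, show q + (n + k) = n + (q + k) by ring]
  field_simp
  ring

theorem boundary_term_eq (r B : ℝ) (hr : r ≠ 0) (n q k j : ℕ) :
    r ^ (n + (k + 1)) * Real.Gamma ((((2 * (n + (q + k + j + 1)) + 1 : ℕ) : ℝ) + 1) / 2) /
        (Real.Gamma ((k + 1 : ℕ) : ℝ) * r ^ (2 * (n + (q + k + j + 1)) + 1) *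
          pochhammerSymbol ((((2 * (n + (q + k + j + 1)) + 1 : ℕ) : ℝ) - 1) / 2 - (j : ℝ) - (n : ℝ))
            (1 - ((k + 1 : ℕ) : ℤ))) *
      (B ^ (n + (k + 1) + 2 * j + 1) * besselI (n + (k + 1) - 1) (2 * r * B) /
        (Real.Gamma ((n : ℝ) + ((k + 1 : ℕ) : ℝ) + (j : ℝ) + 1) * Real.exp (r ^ 2 + B ^ 2))) =
      ((q + k).choose k : ℝ) *
        ((n + (q + k + j + 1)).factorial / (n + k + j + 1).factorial * (r ^ 2) ^ k *
          (B ^ (2 * (n + k + j + 1)) * Real.exp (-(r ^ 2 + B ^ 2)) *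
            besselSeries (n + k) (r ^ 2 * B ^ 2))) / (r ^ 2) ^ (q + k + j + 1) := by
  have e1 : (((2 * (n + (q + k + j + 1)) + 1 : ℕ) : ℝ) + 1) / 2 =
      ((n + (q + k + j + 1) : ℕ) : ℝ) + 1 := by push_cast; ring
  have e2 : (((2 * (n + (q + k + j + 1)) + 1 : ℕ) : ℝ) - 1) / 2 - (j : ℝ) - (n : ℝ) =
      (q : ℝ) + k + 1 := by push_cast; ring
  have e3 : (n : ℝ) + ((k + 1 : ℕ) : ℝ) + (j : ℝ) + 1 = ((n + k + j + 1 : ℕ) : ℝ) + 1 := by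
    push_cast; ring
  have e4 : 1 - ((k + 1 : ℕ) : ℤ) = -(k : ℤ) := by push_cast; ring
  have hC : ((q + k).choose k : ℝ) = (q + k).factorial / (k.factorial * q.factorial) := by
    rw [add_comm q k, Nat.cast_add_choose]
  rw [e1, e2, e3, e4, hC, pochhammerSymbol_natCast, Real.Gamma_nat_eq_factorial,
    Real.Gamma_nat_eq_factorial, Nat.cast_succ k, Real.Gamma_nat_eq_factorial,
    show n + (k + 1) - 1 = n + k by omega, besselI_eq_pow_mul_besselSeries, Real.exp_neg, mul_pow]
  field_simp
  ring

theorem sum_boundary_terms_eq (r B : ℝ) (hr : r ≠ 0) (n p : ℕ) :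
    ∑ l ∈ Finset.Icc 1 p, ∑ j ∈ Finset.Icc 0 (p - l),
        r ^ (n + l) * Real.Gamma ((((2 * (n + p) + 1 : ℕ) : ℝ) + 1) / 2) /
            (Real.Gamma (l : ℝ) * r ^ (2 * (n + p) + 1) *
              pochhammerSymbol ((((2 * (n + p) + 1 : ℕ) : ℝ) - 1) / 2 - (j : ℝ) - (n : ℝ))
                (1 - (l : ℤ))) *
          (B ^ (n + l + 2 * j + 1) * besselI (n + l - 1) (2 * r * B) /
            (Real.Gamma ((n : ℝ) + (l : ℝ) + (j : ℝ) + 1) * Real.exp (r ^ 2 + B ^ 2))) =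
      (∑ j ∈ Finset.range p, ∑ k ∈ Finset.range p, ((p - 1 - j).choose k : ℝ) *
        ((n + p).factorial / (n + k + j + 1).factorial * (r ^ 2) ^ k *
          (B ^ (2 * (n + k + j + 1)) * Real.exp (-(r ^ 2 + B ^ 2)) *
            besselSeries (n + k) (r ^ 2 * B ^ 2)))) / (r ^ 2) ^ p := by
  rw [sum_Icc_one_eq_sum_range, Finset.sum_comm, Finset.sum_div]
  refine Finset.sum_congr rfl fun k hk => ?_
  have hk' := Finset.mem_range.1 hk
  rw [Finset.sum_div]
  -- The triangle `k + j < p` sits in a square; outside it the binomial `(p-1-j choose k)` is 0.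
  have hsub : Finset.Icc 0 (p - (k + 1)) ⊆ Finset.range p := fun j hj => by
    simp only [Finset.mem_Icc, Finset.mem_range] at *
    omega
  rw [← Finset.sum_subset hsub]
  · refine Finset.sum_congr rfl fun j hj => ?_
    obtain ⟨q, rfl⟩ : ∃ q, p = q + k + j + 1 :=
      ⟨p - k - j - 1, by simp only [Finset.mem_Icc] at hj; omega⟩
    rw [boundary_term_eq r B hr, show q + k + j + 1 - 1 - j = q + k by omega]
  · intro j hj hj'
    simp only [Finset.mem_Icc, Finset.mem_range] at hj hj'
    rw [Nat.choose_eq_zero_of_lt (by omega)]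
    simp

theorem sum_marcum_terms_eq (r B : ℝ) (hr : r ≠ 0) (hB : 0 < B) (n p : ℕ) :
    ∑ l ∈ Finset.Icc 1 (p + 1),
        r ^ (2 * (n : ℤ) + 2 * (l : ℤ) - ((2 * (n + p) + 1 : ℕ) : ℤ) - 1) *
              Real.Gamma ((((2 * (n + p) + 1 : ℕ) : ℝ) + 1) / 2 - (n : ℝ)) /
            (Real.Gamma (l : ℝ) * Real.Gamma ((n : ℝ) + (l : ℝ)) *
              pochhammerSymbol ((((2 * (n + p) + 1 : ℕ) : ℝ) + 1) / 2) (1 - (n : ℤ) - (l : ℤ))) *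
          (marcumQ1 (Real.sqrt 2 * r) (Real.sqrt 2 * B) +
            ∑ i ∈ Finset.Icc 1 (n + l - 1),
              B ^ i * besselI i (2 * r * B) / (r ^ i * Real.exp (r ^ 2 + B ^ 2))) =
      (∑ k ∈ Finset.range (p + 1), (p.choose k : ℝ) * ((n + p).factorial / (n + k).factorial) *
        (r ^ 2) ^ k * (1 - besselMoment r B (n + k) 0)) / (r ^ 2) ^ p := by
  rw [sum_Icc_one_eq_sum_range, Finset.sum_div]
  refine Finset.sum_congr rfl fun k hk => ?_
  obtain ⟨q, rfl⟩ : ∃ q, p = q + k := ⟨p - k, by have := Finset.mem_range.1 hk; omega⟩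
  rw [marcum_coefficient_eq r hr, show n + (k + 1) - 1 = n + k by omega,
    one_sub_besselMoment_eq r B hr hB]
  ring

theorem kummer_term_eq (r : ℝ) (n p : ℕ) :
    Real.Gamma ((((2 * (n + p) + 1 : ℕ) : ℝ) + 1) / 2) /
          (r ^ (((2 * (n + p) + 1 : ℕ) : ℤ) - 2 * (n : ℤ) - 1) * (n.factorial : ℝ)) *
        kummer1F1 ((n : ℝ) + (1 - ((2 * (n + p) + 1 : ℕ) : ℝ)) / 2) ((n : ℝ) + 1) (-r ^ 2) =
      (∑ k ∈ Finset.range (p + 1), (p.choose k : ℝ) * ((n + p).factorial / (n + k).factorial) *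
        (r ^ 2) ^ k) / (r ^ 2) ^ p := by
  rw [show (n : ℝ) + (1 - ((2 * (n + p) + 1 : ℕ) : ℝ)) / 2 = -(p : ℝ) by push_cast; ring,
    show (((2 * (n + p) + 1 : ℕ) : ℝ) + 1) / 2 = ((n + p : ℕ) : ℝ) + 1 by push_cast; ring,
    show ((2 * (n + p) + 1 : ℕ) : ℤ) - 2 * (n : ℤ) - 1 = ((2 * p : ℕ) : ℤ) by push_cast; ring,
    kummer1F1_neg_nat, Real.Gamma_nat_eq_factorial, zpow_natCast, pow_mul, Finset.mul_sum,
    Finset.sum_div]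
  refine Finset.sum_congr rfl fun k _ => ?_
  have : (n.factorial : ℝ) ≠ 0 := by positivity
  field_simp

/-- Closed form of the incomplete Toronto function for `m > 2n` with `m/2 - n` not an integer.
Then `m` is odd, so the natural-number quotients in the summation ranges are exact. -/
theorem theorem3 (r B : ℝ) (hr : r ≠ 0) (hB : 0 < B) (m n : ℕ) (hm : 0 < m)
    (hmn : 2 * n < m) (hodd : ∀ k : ℕ, (m : ℝ) / 2 - (n : ℝ) ≠ (k : ℝ)) :
    incompleteToronto B m n r =
      Real.Gamma (((m : ℝ) + 1) / 2) / (r ^ ((m : ℤ) - 2 * (n : ℤ) - 1) * (n.factorial : ℝ)) *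
          kummer1F1 ((n : ℝ) + (1 - (m : ℝ)) / 2) ((n : ℝ) + 1) (-r ^ 2)
      - ∑ l ∈ Finset.Icc 1 ((m - 1) / 2 - n), ∑ j ∈ Finset.Icc 0 ((m - 1) / 2 - n - l),
          r ^ (n + l) * Real.Gamma (((m : ℝ) + 1) / 2) /
              (Real.Gamma (l : ℝ) * r ^ m *
                pochhammerSymbol (((m : ℝ) - 1) / 2 - (j : ℝ) - (n : ℝ)) (1 - (l : ℤ))) *
            (B ^ (n + l + 2 * j + 1) * besselI (n + l - 1) (2 * r * B) /
              (Real.Gamma ((n : ℝ) + (l : ℝ) + (j : ℝ) + 1) * Real.exp (r ^ 2 + B ^ 2)))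
      - ∑ l ∈ Finset.Icc 1 ((m + 1) / 2 - n),
          r ^ (2 * (n : ℤ) + 2 * (l : ℤ) - (m : ℤ) - 1) *
                Real.Gamma (((m : ℝ) + 1) / 2 - (n : ℝ)) /
              (Real.Gamma (l : ℝ) * Real.Gamma ((n : ℝ) + (l : ℝ)) *
                pochhammerSymbol (((m : ℝ) + 1) / 2) (1 - (n : ℤ) - (l : ℤ))) *
            (marcumQ1 (Real.sqrt 2 * r) (Real.sqrt 2 * B) +
              ∑ i ∈ Finset.Icc 1 (n + l - 1),
                B ^ i * besselI i (2 * r * B) / (r ^ i * Real.exp (r ^ 2 + B ^ 2))) := by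

  obtain ⟨p, rfl⟩ : ∃ p, m = 2 * (n + p) + 1 := by
    rcases Nat.even_or_odd' m with ⟨c, rfl | rfl⟩
    -- For `m = 2c`, `m/2 - n` would be the natural number `c - n`.
    · refine absurd ?_ (hodd (c - n))
      rw [Nat.cast_sub (by omega)]
      push_cast
      ring
    · exact ⟨c - n, by omega⟩
  rw [show (2 * (n + p) + 1 - 1) / 2 - n = p by omega,
    show (2 * (n + p) + 1 + 1) / 2 - n = p + 1 by omega,
    sum_boundary_terms_eq r B hr, sum_marcum_terms_eq r B hr hB, kummer_term_eq,
    incompleteToronto_eq_besselMoment r B hr, besselMoment_eq_sum]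
  simp only [mul_sub, mul_one, Finset.sum_sub_distrib]
  ring
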